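/- All graphs are finite and simple. The chromatic symmetric function of a graph $G$ is $$\mathbf X_G=\sum_{\kappa}\ \prod_{v\in V(G)}x_{\kappa(v)},$$ a formal power series in countably many commuting indeterminates $x_1,x_2,\dots$, where the sum runs over all proper colorings $\kappa:V(G)\to\{1,2,3,\dots\}$, i.e. all functions with $\kappa(v)\ne\kappa(w)$ whenever $v$ and $w$ are adjacent. A graph is unicyclic if it contains exactly one cycle. A squid is a connected unicyclic graph with exactly one vertex of degree greater than $2$. **Theorem.** No two non-isomorphic squids have the same chromatic symmetric function; that is, if $S$ and $S'$ are squids with $\mathbf X_S=\mathbf X_{S'}$, then $S$ and $S'$ are isomorphic. -/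

import Mathlib

/-- The chromatic symmetric function of a graph with finitely many vertices,
`X_G = ∑_κ ∏_{v ∈ V(G)} x_{κ(v)}`, summed over all proper colorings `κ : V(G) → {1, 2, 3, …}`,
as a formal power series in the countably many commuting variables `x₁, x₂, …`: the coefficient
of a monomial `x^d` is the number of proper colorings `κ` with `∏_v x_{κ(v)} = x^d`. -/
noncomputable def SimpleGraph.chromaticSymmetricFunction {V : Type*} [Fintype V]
    (G : SimpleGraph V) : MvPowerSeries ℕ+ ℚ :=
  fun d => (Nat.card {κ : G.Coloring ℕ+ // ∑ v, Finsupp.single (κ v) 1 = d} : ℚ)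

/-- Only finitely many proper colorings contribute to a given monomial, so that the `Nat.card` in
the definition above is the true number of them. -/
theorem SimpleGraph.finite_coloring_monomial {V : Type*} [Fintype V] (G : SimpleGraph V)
    (d : ℕ+ →₀ ℕ) : Finite {κ : G.Coloring ℕ+ // ∑ v, Finsupp.single (κ v) 1 = d} := by
  have key : ∀ κ : {κ : G.Coloring ℕ+ // ∑ v, Finsupp.single (κ v) 1 = d},
      ∀ v, κ.1 v ∈ d.support := by
    rintro ⟨κ, rfl⟩ v
    rw [Finsupp.mem_support_iff, Finsupp.finsetSum_apply]
    intro h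
    have := (Finset.sum_eq_zero_iff.mp h) v (Finset.mem_univ v)
    simp at this
  refine Finite.of_injective
    (fun κ => fun v => (⟨κ.1 v, key κ v⟩ : {i // i ∈ d.support})) ?_
  intro κ κ' h
  apply Subtype.ext
  apply DFunLike.ext
  intro v
  exact congrArg Subtype.val (congrFun h v)

open scoped MvPowerSeries.WithPiTopology in
/-- The chromatic symmetric function is the sum of the infinite series `∑_κ ∏_v x_{κ(v)}`, with
respect to coefficientwise convergence. -/
theorem SimpleGraph.hasSum_chromaticSymmetricFunction {V : Type*} [Fintype V]
    (G : SimpleGraph V) :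
    HasSum (fun κ : G.Coloring ℕ+ => ∏ v, (MvPowerSeries.X (κ v) : MvPowerSeries ℕ+ ℚ))
      G.chromaticSymmetricFunction := by
  classical
  rw [MvPowerSeries.WithPiTopology.hasSum_iff_hasSum_coeff]
  intro d
  have hprod : ∀ κ : G.Coloring ℕ+, MvPowerSeries.coeff d
      (∏ v, (MvPowerSeries.X (κ v) : MvPowerSeries ℕ+ ℚ)) =
      if ∑ v, Finsupp.single (κ v) 1 = d then 1 else 0 := by
    intro κ
    simp only [MvPowerSeries.X_def, MvPowerSeries.prod_monomial, MvPowerSeries.coeff_monomial,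
      Finset.prod_const_one, eq_comm]
  have hfin : {κ : G.Coloring ℕ+ | ∑ v, Finsupp.single (κ v) 1 = d}.Finite :=
    G.finite_coloring_monomial d
  have hcard : MvPowerSeries.coeff d G.chromaticSymmetricFunction =
      ∑ κ ∈ hfin.toFinset, MvPowerSeries.coeff d
        (∏ v, (MvPowerSeries.X (κ v) : MvPowerSeries ℕ+ ℚ)) := by
    have h1 : MvPowerSeries.coeff d G.chromaticSymmetricFunction =
        (Nat.card {κ : G.Coloring ℕ+ // ∑ v, Finsupp.single (κ v) 1 = d} : ℚ) := rfl
    have h2 : Nat.card {κ : G.Coloring ℕ+ // ∑ v, Finsupp.single (κ v) 1 = d} =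
        hfin.toFinset.card := Nat.card_eq_card_finite_toFinset hfin
    rw [h1, h2, Finset.sum_congr rfl fun κ hκ => ?_, Finset.sum_const, nsmul_eq_mul, mul_one]
    rw [hprod, if_pos (by simpa using hκ)]
  rw [hcard]
  refine hasSum_sum_of_ne_finset_zero fun κ hκ => ?_
  rw [hprod, if_neg (by simpa using hκ)]

/-- `G` is unicyclic: it contains exactly one cycle (a cycle being regarded as a subgraph, so that
its starting point and its orientation do not matter). -/
def SimpleGraph.IsUnicyclic {V : Type*} (G : SimpleGraph V) : Prop :=
  ∃! C : G.Subgraph, ∃ (v : V) (p : G.Walk v v), p.IsCycle ∧ p.toSubgraph = C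

/-- A squid is a connected unicyclic graph with exactly one vertex of degree greater than `2`. -/
def SimpleGraph.IsSquid {V : Type*} (G : SimpleGraph V) [G.LocallyFinite] : Prop :=
  G.Connected ∧ G.IsUnicyclic ∧ ∃! v : V, 2 < G.degree v

/-! Colour the vertices by pairs in `ZMod q × ZMod 2` and record the number `j` of vertices whose
second component is nonzero. The chromatic symmetric function determines the number of such
colourings (`card_coloring_eq`). The second components select a set `S` of `j` vertices, and the
first components then colour `G[S]` and its complement `G[Sᶜ]` properly and independently. So the
count is the value at `q` of a polynomial, the sum over `|S| = j` of the products of the chromatic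
polynomials of `G[S]` and `G[Sᶜ]`. For a squid this is `squidPoly`, computed from the increments of
both components along the edges (`card_squidGraph_coloring`).

A chromatic polynomial is divisible by `X` once for each component. For `j = 0` the linear
coefficient is `± L`, where the cycle has length `L + 1` (`squidPoly_zero_coeff_one`). For `0 < j <
n`, with `n` the number of vertices, the quadratic coefficient sees only the `S` for which `G[S]`
and `G[Sᶜ]` are both connected: the cut crosses two cycle edges or one tentacle edge. The cycle cuts
contribute an amount depending only on `L`, `n` and `j`; a tentacle edge contributes `± L`. Hence `t
j + t (n - j)` is known, where `t s` counts the tentacles of length at least `s`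
(`squidPoly_coeff_two`, `sum_tentacles`).

These symmetric sums determine `t`: at most one tentacle is longer than `n / 2`, and the sums at its
length and one further show that it cannot be absent from the other squid
(`tentacleCount_not_long`). Finally `t` determines the tentacle lengths, hence the squid. -/

namespace SimpleGraph

/-! ### Colourings in finite colour sets. -/

/-- The content of a colouring: the number of times that each colour is used. -/
noncomputable def Coloring.content {V A : Type*} [Fintype V] {G : SimpleGraph V}
    (f : G.Coloring A) : A →₀ ℕ := ∑ v, Finsupp.single (f v) 1

theorem Coloring.sum_content {V A M : Type*} [Fintype V] [Fintype A] [AddCommMonoid M]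
    {G : SimpleGraph V} (f : G.Coloring A) (φ : A → M) :
    ∑ a, f.content a • φ a = ∑ v, φ (f v) := by
  classical
  simp only [Coloring.content, Finsupp.finsetSum_apply, Finset.sum_smul]
  rw [Finset.sum_comm]
  refine Finset.sum_congr rfl fun v _ => ?_
  rw [Finset.sum_eq_single (f v)] <;> simp +contextual [eq_comm]

/-- A colouring by positive integers whose monomial involves only the variables indexed by the image
of `τ` takes all its values in that image, so it factors through `A`. -/
theorem card_content_eq_coeff {V A : Type*} [Fintype V] (G : SimpleGraph V)
    (τ : A ↪ ℕ+) (γ : A →₀ ℕ) :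
    (Nat.card {f : G.Coloring A // f.content = γ} : ℚ) =
      G.chromaticSymmetricFunction (γ.mapDomain τ) := by
  unfold chromaticSymmetricFunction
  congr 1
  have hmap : ∀ f : V → A, (∑ v, Finsupp.single (f v) 1 : A →₀ ℕ).mapDomain τ =
      ∑ v, Finsupp.single (τ (f v)) 1 := by
    intro f
    simp [Finsupp.mapDomain_finsetSum]
  refine Nat.card_eq_of_bijective
    (fun f => ⟨Coloring.mk (fun v => τ (f.1 v)) fun h => fun h' => f.1.valid h (τ.injective h'),
      by
        exact (hmap f.1).symm.trans (congrArg _ f.2)⟩) ⟨?_, ?_⟩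
  · intro f g h
    apply Subtype.ext
    apply DFunLike.ext
    intro v
    apply τ.injective
    exact congrArg (fun κ : G.Coloring ℕ+ => κ v) (congrArg Subtype.val h)
  · rintro ⟨κ, hκ⟩
    have hr : ∀ v, ∃ a, τ a = κ v := by
      intro v
      have hv : κ v ∈ (γ.mapDomain τ).support := by
        rw [← hκ, Finsupp.mem_support_iff, Finsupp.finsetSum_apply]
        intro h
        have := (Finset.sum_eq_zero_iff.mp h) v (Finset.mem_univ v)
        simp at this
      classical
      have := Finsupp.mapDomain_support hv
      obtain ⟨a, -, ha⟩ := Finset.mem_image.mp this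
      exact ⟨a, ha⟩
    choose f hf using hr
    refine ⟨⟨Coloring.mk f fun {u v} h h' => κ.valid h (by rw [← hf, ← hf, h']), ?_⟩, ?_⟩
    · apply Finsupp.mapDomain_injective τ.injective
      refine (hmap f).trans ?_
      simp only [hf]
      exact hκ
    · apply Subtype.ext
      apply DFunLike.ext
      exact hf

/-- Graphs with the same chromatic symmetric function have the same colourings in any finite set
of colours, up to a bijection that preserves the content. -/
theorem exists_coloring_equiv {V W A : Type*} [Fintype V] [Fintype W] [Finite A]
    {G : SimpleGraph V} {H : SimpleGraph W}
    (hX : G.chromaticSymmetricFunction = H.chromaticSymmetricFunction) :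
    ∃ e : G.Coloring A ≃ H.Coloring A, ∀ f, (e f).content = f.content := by
  obtain ⟨τ⟩ : Nonempty (A ↪ ℕ+) := by
    have := Fintype.ofFinite A
    exact ⟨(Fintype.equivFin A).toEmbedding.trans
      ⟨fun i => ⟨i + 1, Nat.succ_pos _⟩, fun i j h => by
        simpa [Fin.ext_iff] using congrArg PNat.val h⟩⟩
  have hcard : ∀ γ : A →₀ ℕ, Nat.card {f : G.Coloring A // f.content = γ} =
      Nat.card {f : H.Coloring A // f.content = γ} := by
    intro γ
    have := card_content_eq_coeff G τ γ
    rw [hX, ← card_content_eq_coeff H τ γ] at this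
    exact_mod_cast this
  have : Finite (G.Coloring A) := Finite.of_injective _ DFunLike.coe_injective
  have : Finite (H.Coloring A) := Finite.of_injective _ DFunLike.coe_injective
  refine ⟨Equiv.ofFiberEquiv (f := Coloring.content) (g := Coloring.content)
    fun γ => Classical.choice (Finite.card_eq.mp (hcard γ)), fun f => ?_⟩
  exact Equiv.ofFiberEquiv_map _ f

theorem card_coloring_eq {V W A : Type*} [Fintype V] [Fintype W] [Fintype A]
    {G : SimpleGraph V} {H : SimpleGraph W}
    (hX : G.chromaticSymmetricFunction = H.chromaticSymmetricFunction) (φ : A → ℕ) (j : ℕ) :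
    Nat.card {f : G.Coloring A // ∑ v, φ (f v) = j} =
      Nat.card {f : H.Coloring A // ∑ v, φ (f v) = j} := by
  obtain ⟨e, he⟩ := exists_coloring_equiv (A := A) hX
  refine Nat.card_congr (e.subtypeEquiv fun f => ?_)
  rw [← Coloring.sum_content, ← Coloring.sum_content, he]

/-- Contents have total weight equal to the number of vertices, and `selfColoring` ensures that
there is a colouring to compare. -/
theorem card_eq_of_chromaticSymmetricFunction_eq {V W : Type*} [Fintype V] [Fintype W]
    {G : SimpleGraph V} {H : SimpleGraph W}
    (hX : G.chromaticSymmetricFunction = H.chromaticSymmetricFunction) :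
    Fintype.card V = Fintype.card W := by
  obtain ⟨e, he⟩ := exists_coloring_equiv (A := V) hX
  have h := Coloring.sum_content (e G.selfColoring) (fun _ => 1)
  rw [he, Coloring.sum_content] at h
  simpa using h

end SimpleGraph

/-! ### The model squid and its increment coordinates. -/

/-- The vertices of a squid: the center, the other vertices of its cycle, and the vertices of the
tentacles, of which the `i`-th has length `ℓ i`. -/
abbrev SquidVertex (L : ℕ) {κ : Type*} (ℓ : κ → ℕ) := Option (Fin L ⊕ Σ i, Fin (ℓ i))

namespace SquidVertex

variable {L : ℕ} {κ : Type*} {ℓ : κ → ℕ} {A : Type*} [AddCommGroup A]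

/-- The vertices along the cycle, starting from the center. -/
def onCycle : Fin (L + 1) → SquidVertex L ℓ := Fin.cases none fun k => some (.inl k)

/-- The vertices along a tentacle, starting from the center. -/
def onTentacle (i : κ) : Fin (ℓ i + 1) → SquidVertex L ℓ :=
  Fin.cases none fun k => some (.inr ⟨i, k⟩)

@[simp] theorem onCycle_zero : onCycle (ℓ := ℓ) (0 : Fin (L + 1)) = none := rfl
@[simp] theorem onCycle_succ (k : Fin L) : onCycle (ℓ := ℓ) k.succ = some (.inl k) := rfl
@[simp] theorem onTentacle_zero (i : κ) : onTentacle (L := L) i (0 : Fin (ℓ i + 1)) = none := rfl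
@[simp] theorem onTentacle_succ (i : κ) (k : Fin (ℓ i)) :
    onTentacle (L := L) i k.succ = some (.inr ⟨i, k⟩) := rfl

theorem onCycle_injective : Function.Injective (onCycle (L := L) (ℓ := ℓ)) := by
  intro a b
  cases a using Fin.cases <;> cases b using Fin.cases <;> simp

theorem onTentacle_injective (i : κ) : Function.Injective (onTentacle (L := L) (ℓ := ℓ) i) := by
  intro a b
  cases a using Fin.cases <;> cases b using Fin.cases <;> simp

/-- The function on the vertices with given value at the center and given increments along the
cycle and the tentacles. -/
def ofIncrements (a : A) (g : Fin L → A) (g' : (Σ i, Fin (ℓ i)) → A) : SquidVertex L ℓ → A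
  | none => a
  | some (.inl k) => a + Fin.partialSum g k.succ
  | some (.inr ⟨i, k⟩) => a + Fin.partialSum (fun k => g' ⟨i, k⟩) k.succ

@[simp] theorem ofIncrements_none (a : A) (g : Fin L → A) (g' : (Σ i, Fin (ℓ i)) → A) :
    ofIncrements a g g' none = a := rfl

theorem ofIncrements_onCycle (a : A) (g : Fin L → A) (g' : (Σ i, Fin (ℓ i)) → A)
    (k : Fin (L + 1)) : ofIncrements a g g' (onCycle k) = a + Fin.partialSum g k := by
  cases k using Fin.cases <;> simp [ofIncrements]

theorem ofIncrements_onTentacle (a : A) (g : Fin L → A) (g' : (Σ i, Fin (ℓ i)) → A)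
    (i : κ) (k : Fin (ℓ i + 1)) : ofIncrements a g g' (onTentacle i k) =
      a + Fin.partialSum (fun k => g' ⟨i, k⟩) k := by
  cases k using Fin.cases <;> simp [ofIncrements]

/-- Functions on the vertices of a squid are determined by their value at the center and by their
increments. -/
def incrementsEquiv : A × (Fin L → A) × ((Σ i, Fin (ℓ i)) → A) ≃ (SquidVertex L ℓ → A) where
  toFun x := ofIncrements x.1 x.2.1 x.2.2
  invFun f := (f none, fun k => f (onCycle k.succ) - f (onCycle k.castSucc),
    fun t => f (onTentacle t.1 t.2.succ) - f (onTentacle t.1 t.2.castSucc))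
  left_inv := by
    rintro ⟨a, g, g'⟩
    ext
    · rfl
    · simp only [ofIncrements_onCycle, Fin.partialSum_succ]; abel
    · simp only [ofIncrements_onTentacle, Fin.partialSum_succ]; abel
  right_inv := by
    intro f
    have h1 : ∀ k, ofIncrements (f none) (fun k => f (onCycle k.succ) - f (onCycle k.castSucc))
        (fun t => f (onTentacle t.1 t.2.succ) - f (onTentacle t.1 t.2.castSucc)) (onCycle k) =
        f (onCycle k) := by
      intro k
      rw [ofIncrements_onCycle]
      induction k using Fin.induction with
      | zero => simp
      | succ k ih => rw [Fin.partialSum_succ, ← add_assoc, ih]; abel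
    have h2 : ∀ i k, ofIncrements (f none)
        (fun k => f (onCycle k.succ) - f (onCycle k.castSucc))
        (fun t => f (onTentacle t.1 t.2.succ) - f (onTentacle t.1 t.2.castSucc))
        (onTentacle i k) = f (onTentacle i k) := by
      intro i k
      rw [ofIncrements_onTentacle]
      induction k using Fin.induction with
      | zero => simp
      | succ k ih => rw [Fin.partialSum_succ, ← add_assoc, ih]; abel
    funext v
    rcases v with _ | k | ⟨i, k⟩
    · rfl
    · exact h1 k.succ
    · exact h2 i k.succ

end SquidVertex

open SquidVertex in
/-- The squid with a cycle of length `L + 1` and with tentacles of lengths `ℓ i`. -/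
def squidGraph (L : ℕ) {κ : Type*} (ℓ : κ → ℕ) : SimpleGraph (SquidVertex L ℓ) :=
  .fromRel fun u v =>
    (∃ k : Fin L, u = onCycle k.castSucc ∧ v = onCycle k.succ) ∨
    (u = onCycle (Fin.last L) ∧ v = none) ∨
    (∃ i, ∃ k : Fin (ℓ i), u = onTentacle i k.castSucc ∧ v = onTentacle i k.succ)

/-! ### Counting increments on the cycle and on the tentacles. -/

section Counting

variable {L : ℕ} {κ : Type*} {ℓ : κ → ℕ}

-- The condition `0 < L` is needed because for `L = 0` the closing edge would be a loop, which
-- `fromRel` discards.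
open SquidVertex in
theorem squidGraph_proper_iff {A : Type*} (hL : 0 < L) (f : SquidVertex L ℓ → A) :
    (∀ u v, (squidGraph L ℓ).Adj u v → f u ≠ f v) ↔
      (∀ k : Fin L, f (onCycle k.succ) ≠ f (onCycle k.castSucc)) ∧
      f (onCycle (Fin.last L)) ≠ f none ∧
      (∀ i, ∀ k : Fin (ℓ i), f (onTentacle i k.succ) ≠ f (onTentacle i k.castSucc)) := by
  constructor
  · intro h
    refine ⟨fun k => ?_, ?_, fun i k => ?_⟩
    · refine h _ _ ((SimpleGraph.fromRel_adj ..).mpr ⟨?_, .inr (.inl ⟨k, rfl, rfl⟩)⟩)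
      exact fun h' => (Fin.castSucc_lt_succ (i := k)).ne' (onCycle_injective h')
    · refine h _ _ ((SimpleGraph.fromRel_adj ..).mpr ⟨?_, .inl (.inr (.inl ⟨rfl, rfl⟩))⟩)
      rw [← onCycle_zero]
      intro h'
      have := congrArg Fin.val (onCycle_injective h')
      simp at this
      omega
    · refine h _ _ ((SimpleGraph.fromRel_adj ..).mpr
        ⟨?_, .inr (.inr (.inr ⟨i, k, rfl, rfl⟩))⟩)
      exact fun h' => (Fin.castSucc_lt_succ (i := k)).ne' (onTentacle_injective i h')
  · rintro ⟨h1, h2, h3⟩ u v huv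
    obtain ⟨-, h | h⟩ := (SimpleGraph.fromRel_adj ..).mp huv
    · rcases h with ⟨k, rfl, rfl⟩ | ⟨rfl, rfl⟩ | ⟨i, k, rfl, rfl⟩
      exacts [(h1 k).symm, h2, (h3 i k).symm]
    · rcases h with ⟨k, rfl, rfl⟩ | ⟨rfl, rfl⟩ | ⟨i, k, rfl, rfl⟩
      exacts [h1 k, h2.symm, h3 i k]

theorem Fin.partialSum_last' {A : Type*} [AddCommMonoid A] (g : Fin L → A) :
    Fin.partialSum g (Fin.last L) = ∑ k, g k := by
  rw [Fin.partialSum, Fin.val_last, List.take_of_length_le (by simp), List.sum_ofFn]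

open Polynomial

/-- The polynomial that counts, for a group of order `q`, the functions that do not vanish where
`δ` vanishes. -/
noncomputable def supportPoly {T : Type*} [Fintype T] (δ : T → ZMod 2) : ℤ[X] :=
  ∏ t, if δ t = 0 then X - 1 else X

theorem card_support {T : Type*} [Fintype T] (δ : T → ZMod 2) (q : ℕ) [NeZero q] :
    (Nat.card {h : T → ZMod q // ∀ t, ¬ (h t = 0 ∧ δ t = 0)} : ℤ) =
      (supportPoly δ).eval (q : ℤ) := by
  classical
  have e : {h : T → ZMod q // ∀ t, ¬ (h t = 0 ∧ δ t = 0)} ≃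
      (∀ t, {x : ZMod q // ¬ (x = 0 ∧ δ t = 0)}) :=
    Equiv.subtypePiEquivPi (p := fun t x => ¬ (x = 0 ∧ δ t = 0))
  rw [Nat.card_congr e, Nat.card_pi, supportPoly, eval_prod, Nat.cast_prod]
  refine Finset.prod_congr rfl fun t _ => ?_
  by_cases ht : δ t = 0
  · have : 0 < q := Nat.pos_of_neZero q
    simp [ht, Fintype.card_subtype_compl, ZMod.card, Nat.cast_sub this]
  · simp [ht]

/-- The polynomial that counts the functions that in addition have sum zero. -/
noncomputable def closedPoly : {L : ℕ} → (Fin L → ZMod 2) → ℤ[X]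
  | 0, _ => 1
  | _ + 1, δ => supportPoly (Fin.tail δ) - if δ 0 = 0 then closedPoly (Fin.tail δ) else 0

theorem card_and_not_add {α : Type*} [Finite α] (p r : α → Prop) :
    (Nat.card {x // p x ∧ ¬ r x} : ℤ) = Nat.card {x // p x} - Nat.card {x // p x ∧ r x} := by
  have h := Set.ncard_inter_add_ncard_sdiff_eq_ncard {x | p x} {x | r x}
  have h1 : Nat.card {x // p x ∧ ¬ r x} = ({x | p x} \ {x | r x}).ncard := rfl
  have h2 : Nat.card {x // p x ∧ r x} = ({x | p x} ∩ {x | r x}).ncard := rfl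
  have h3 : Nat.card {x // p x} = {x | p x}.ncard := rfl
  rw [h1, h2, h3, ← h]
  push_cast
  ring

/-- The sum condition makes the entry at `0` minus the sum of the others. These are subject to their
own conditions and, if `δ 0 = 0`, to having nonzero sum; this is the recursion that defines
`closedPoly`. -/
theorem card_closed (δ : Fin L → ZMod 2) (q : ℕ) [NeZero q] :
    (Nat.card {h : Fin L → ZMod q // (∀ t, ¬ (h t = 0 ∧ δ t = 0)) ∧ ∑ t, h t = 0} : ℤ) =
      (closedPoly δ).eval (q : ℤ) := by
  induction L with
  | zero => simp [closedPoly]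
  | succ L ih =>
    have e : {h : Fin (L + 1) → ZMod q // (∀ t, ¬ (h t = 0 ∧ δ t = 0)) ∧ ∑ t, h t = 0} ≃
        {h : Fin L → ZMod q // (∀ t, ¬ (h t = 0 ∧ Fin.tail δ t = 0)) ∧
          ¬ (∑ t, h t = 0 ∧ δ 0 = 0)} :=
      { toFun h := ⟨Fin.tail h.1, fun t => h.2.1 t.succ, by
          have h0 := h.2.1 0
          have hs := h.2.2
          rw [Fin.sum_univ_succ] at hs
          rintro ⟨h1, h2⟩
          exact h0 ⟨(add_eq_left.mpr h1).symm.trans hs, h2⟩⟩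
        invFun h := ⟨Fin.cons (- ∑ t, h.1 t) h.1, fun t => by
          cases t using Fin.cases with
          | zero => simpa using h.2.2
          | succ t => exact h.2.1 t, by simp [Fin.sum_univ_succ]⟩
        left_inv h := by
          have hs := h.2.2
          rw [Fin.sum_univ_succ] at hs
          apply Subtype.ext
          funext t
          cases t using Fin.cases with
          | zero => exact (eq_neg_of_add_eq_zero_left hs).symm
          | succ t => rfl
        right_inv h := rfl }
    rw [Nat.card_congr e, card_and_not_add, card_support, closedPoly, eval_sub]
    congr 1
    by_cases h0 : δ 0 = 0
    · simp only [h0, and_true, if_true, ih]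
    · simp [h0]

/-- The polynomial that counts the functions that do not vanish where `δ` vanishes, and whose sum
does not vanish if the sum of `δ` does. -/
noncomputable def cyclePoly (δ : Fin L → ZMod 2) : ℤ[X] :=
  supportPoly δ - if ∑ t, δ t = 0 then closedPoly δ else 0

theorem card_cycle (δ : Fin L → ZMod 2) (q : ℕ) [NeZero q] :
    (Nat.card {h : Fin L → ZMod q // (∀ t, ¬ (h t = 0 ∧ δ t = 0)) ∧
      ¬ (∑ t, h t = 0 ∧ ∑ t, δ t = 0)} : ℤ) = (cyclePoly δ).eval (q : ℤ) := by
  rw [card_and_not_add, card_support, cyclePoly, eval_sub]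
  congr 1
  by_cases h0 : ∑ t, δ t = 0
  · simp only [h0, and_true, if_true, card_closed]
  · simp [h0]

theorem supportPoly_eval_zero {T : Type*} [Fintype T] (δ : T → ZMod 2) :
    (supportPoly δ).eval 0 = if δ = 0 then (-1) ^ Fintype.card T else 0 := by
  rw [supportPoly, eval_prod]
  split_ifs with h
  · simp [h]
  · obtain ⟨t, ht⟩ := Function.ne_iff.mp h
    exact Finset.prod_eq_zero (Finset.mem_univ t) (by rw [if_neg (show ¬ δ t = 0 from ht), eval_X])

theorem closedPoly_zero_eval_zero :
    (closedPoly (0 : Fin L → ZMod 2)).eval 0 = (-1) ^ (L + 1) * ((L : ℤ) - 1) := by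
  induction L with
  | zero => simp [closedPoly]
  | succ L ih =>
    have : Fin.tail (0 : Fin (L + 1) → ZMod 2) = 0 := rfl
    simp [closedPoly, supportPoly_eval_zero, this, ih]
    ring

/-- A vanishing sum prevents `δ` from being supported at `0` alone. Hence the tail is nonzero and
its `supportPoly` has a factor `X`; the subtracted term is handled by induction. -/
theorem closedPoly_eval_zero {δ : Fin L → ZMod 2} (h : δ ≠ 0) (hs : ∑ t, δ t = 0) :
    (closedPoly δ).eval 0 = 0 := by
  induction L with
  | zero => exact absurd (Subsingleton.elim _ _) h
  | succ L ih =>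
    rw [Fin.sum_univ_succ] at hs
    have ht : Fin.tail δ ≠ 0 := by
      intro ht
      have h0 : ∀ t : Fin L, δ t.succ = 0 := congrFun ht
      apply h
      funext t
      cases t using Fin.cases with
      | zero => simpa [h0] using hs
      | succ t => exact h0 t
    rw [closedPoly, eval_sub, supportPoly_eval_zero, if_neg ht]
    split_ifs with h0
    · rw [ih ht (by rwa [h0, zero_add] at hs), sub_zero]
    · simp

/-- If `δ ≠ 0`, the cut breaks the cycle into at least two pieces. As the choice of the value at the
center is not counted here, this leaves a factor `X`. -/
theorem cyclePoly_eval_zero (δ : Fin L → ZMod 2) :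
    (cyclePoly δ).eval 0 = if δ = 0 then (-1) ^ L * (L : ℤ) else 0 := by
  rw [cyclePoly, eval_sub, supportPoly_eval_zero]
  split_ifs with h h' h'
  · rw [h, closedPoly_zero_eval_zero]
    simp
    ring
  · simp [h] at h'
  · rw [closedPoly_eval_zero h h', sub_zero]
  · simp

end Counting

/-! ### The counting polynomial of a squid. -/

section Counting

variable {L : ℕ} {κ : Type*} {ℓ : κ → ℕ}

open Polynomial

theorem card_subtype_prod_and {X Y : Type*} [Fintype X] [Finite Y] (p : X → Prop)
    [DecidablePred p] (r : X → Y → Prop) :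
    Nat.card {z : X × Y // p z.1 ∧ r z.1 z.2} = ∑ x, if p x then Nat.card {y // r x y} else 0 := by
  rw [Nat.card_congr (Equiv.subtypeProdEquivSigmaSubtype fun x y => p x ∧ r x y), Nat.card_sigma]
  refine Finset.sum_congr rfl fun x _ => ?_
  split_ifs with h <;> simp [h]

/-- The number of vertices at which a function to `ZMod 2` with given increments is nonzero. -/
def squidWeight [Fintype κ] (b : ZMod 2) (δ : Fin L → ZMod 2)
    (δ' : (Σ i, Fin (ℓ i)) → ZMod 2) : ℕ :=
  ∑ v, (SquidVertex.ofIncrements b δ δ' v).val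

/-- The polynomial that counts the colourings of a squid with colours in `ZMod q × ZMod 2` for
which the second component is nonzero at `j` vertices. -/
noncomputable def squidPoly (L : ℕ) {κ : Type*} [Fintype κ] [DecidableEq κ] (ℓ : κ → ℕ) (j : ℕ) :
    ℤ[X] :=
  ∑ b : ZMod 2, ∑ δ : Fin L → ZMod 2, ∑ δ' : (Σ i, Fin (ℓ i)) → ZMod 2,
    if squidWeight b δ δ' = j then X * (cyclePoly δ * supportPoly δ') else 0

/-- Colourings as functions. -/
def SimpleGraph.coloringSubtypeEquiv {V A : Type*} (G : SimpleGraph V) (p : (V → A) → Prop) :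
    {f : G.Coloring A // p f} ≃ {f : V → A // (∀ u v, G.Adj u v → f u ≠ f v) ∧ p f} where
  toFun f := ⟨f.1, fun _ _ h => f.1.valid h, f.2⟩
  invFun f := ⟨Coloring.mk f.1 fun {u v} h => f.2.1 u v h, f.2.2⟩
  left_inv _ := rfl
  right_inv _ := rfl

-- In increment coordinates properness separates over the cycle and the tentacles. The increment on
-- the closing edge is determined by the total along the cycle, which gives the sum condition in
-- `cyclePoly`; the factor `X` counts the free value at the center.
open SquidVertex in
theorem card_squidGraph_coloring [Fintype κ] [DecidableEq κ] (hL : 0 < L) (q j : ℕ) [NeZero q] :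
    (Nat.card {f : (squidGraph L ℓ).Coloring (ZMod q × ZMod 2) // ∑ v, (f v).2.val = j} : ℤ) =
      (squidPoly L ℓ j).eval (q : ℤ) := by
  let E : (ZMod 2 × (Fin L → ZMod 2) × ((Σ i, Fin (ℓ i)) → ZMod 2)) ×
      (ZMod q × (Fin L → ZMod q) × ((Σ i, Fin (ℓ i)) → ZMod q)) ≃
      (SquidVertex L ℓ → ZMod q × ZMod 2) :=
    (Equiv.prodComm _ _).trans ((Equiv.prodCongr incrementsEquiv incrementsEquiv).trans
      (Equiv.arrowProdEquivProdArrow _ (fun _ => ZMod q) (fun _ => ZMod 2)).symm)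
  have hE : ∀ z v, E z v = (ofIncrements z.2.1 z.2.2.1 z.2.2.2 v,
    ofIncrements z.1.1 z.1.2.1 z.1.2.2 v) := fun _ _ => rfl
  have e1 : {f : SquidVertex L ℓ → ZMod q × ZMod 2 //
      (∀ u v, (squidGraph L ℓ).Adj u v → f u ≠ f v) ∧ ∑ v, (f v).2.val = j} ≃
      {z : (ZMod 2 × (Fin L → ZMod 2) × ((Σ i, Fin (ℓ i)) → ZMod 2)) ×
        (ZMod q × (Fin L → ZMod q) × ((Σ i, Fin (ℓ i)) → ZMod q)) //
        squidWeight z.1.1 z.1.2.1 z.1.2.2 = j ∧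
        (((∀ t, ¬ (z.2.2.1 t = 0 ∧ z.1.2.1 t = 0)) ∧
          ¬ (∑ t, z.2.2.1 t = 0 ∧ ∑ t, z.1.2.1 t = 0)) ∧
          ∀ t, ¬ (z.2.2.2 t = 0 ∧ z.1.2.2 t = 0))} := by
    refine (E.subtypeEquiv fun z => ?_).symm
    rw [squidGraph_proper_iff hL, and_comm]
    simp only [hE, squidWeight, ne_eq, Prod.mk.injEq, ofIncrements_onCycle,
      ofIncrements_onTentacle, ofIncrements_none, Fin.partialSum_last', Fin.partialSum_succ,
      add_eq_left, ← add_assoc, Sigma.forall, and_assoc]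
  rw [Nat.card_congr (((squidGraph L ℓ).coloringSubtypeEquiv _).trans e1),
    card_subtype_prod_and
      (fun x : ZMod 2 × (Fin L → ZMod 2) × ((Σ i, Fin (ℓ i)) → ZMod 2) =>
        squidWeight x.1 x.2.1 x.2.2 = j)
      (fun x (y : ZMod q × (Fin L → ZMod q) × ((Σ i, Fin (ℓ i)) → ZMod q)) =>
        ((∀ t, ¬ (y.2.1 t = 0 ∧ x.2.1 t = 0)) ∧ ¬ (∑ t, y.2.1 t = 0 ∧ ∑ t, x.2.1 t = 0)) ∧
          ∀ t, ¬ (y.2.2 t = 0 ∧ x.2.2 t = 0)),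
    Fintype.sum_prod_type]
  simp only [Fintype.sum_prod_type, squidPoly, eval_finsetSum, Nat.cast_sum]
  refine Finset.sum_congr rfl fun b _ => Finset.sum_congr rfl fun δ _ =>
    Finset.sum_congr rfl fun δ' _ => ?_
  split_ifs
  · have e2 : {y : ZMod q × (Fin L → ZMod q) × ((Σ i, Fin (ℓ i)) → ZMod q) //
        ((∀ t, ¬ (y.2.1 t = 0 ∧ δ t = 0)) ∧ ¬ (∑ t, y.2.1 t = 0 ∧ ∑ t, δ t = 0)) ∧
          ∀ t, ¬ (y.2.2 t = 0 ∧ δ' t = 0)} ≃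
        ZMod q × {h : Fin L → ZMod q // (∀ t, ¬ (h t = 0 ∧ δ t = 0)) ∧
          ¬ (∑ t, h t = 0 ∧ ∑ t, δ t = 0)} × {h : _ → ZMod q // ∀ t, ¬ (h t = 0 ∧ δ' t = 0)} :=
      { toFun y := (y.1.1, ⟨y.1.2.1, y.2.1⟩, ⟨y.1.2.2, y.2.2⟩)
        invFun y := ⟨(y.1, y.2.1.1, y.2.2.1), y.2.1.2, y.2.2.2⟩
        left_inv _ := rfl
        right_inv _ := rfl }
    rw [Nat.card_congr e2, Nat.card_prod, Nat.card_prod, Nat.card_zmod]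
    push_cast
    rw [card_cycle, card_support, eval_mul, eval_mul, eval_X]
  · simp

theorem squidPoly_eq_of_card_eq {L' : ℕ} {κ' : Type*} {ℓ' : κ' → ℕ} [Fintype κ] [DecidableEq κ]
    [Fintype κ'] [DecidableEq κ'] (hL : 0 < L) (hL' : 0 < L') (j : ℕ)
    (h : ∀ q : ℕ, NeZero q →
      Nat.card {f : (squidGraph L ℓ).Coloring (ZMod q × ZMod 2) // ∑ v, (f v).2.val = j} =
      Nat.card {f : (squidGraph L' ℓ').Coloring (ZMod q × ZMod 2) // ∑ v, (f v).2.val = j}) :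
    squidPoly L ℓ j = squidPoly L' ℓ' j := by
  -- Two polynomials that agree at every positive integer are equal.
  refine Polynomial.eq_of_infinite_eval_eq _ _ (Set.Infinite.mono
    (s := Set.range fun n : ℕ => ((n + 1 : ℕ) : ℤ)) ?_ (Set.infinite_range_of_injective ?_))
  · rintro _ ⟨n, rfl⟩
    have := h (n + 1) inferInstance
    simp only [Set.mem_ofPred_eq]
    rw [← card_squidGraph_coloring hL, ← card_squidGraph_coloring hL', this]
  · intro a b hab
    simpa using hab

theorem supportPoly_coeff_zero {T : Type*} [Fintype T] (δ : T → ZMod 2) :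
    (supportPoly δ).coeff 0 = if δ = 0 then (-1) ^ Fintype.card T else 0 := by
  rw [coeff_zero_eq_eval_zero, supportPoly_eval_zero]

theorem cyclePoly_coeff_zero (δ : Fin L → ZMod 2) :
    (cyclePoly δ).coeff 0 = if δ = 0 then (-1) ^ L * (L : ℤ) else 0 := by
  rw [coeff_zero_eq_eval_zero, cyclePoly_eval_zero]

/-- The linear coefficient is the derivative at `0`, in which the factor at `t` is dropped and the
others must be `X - 1`. Summing over `a` treats two cases at once: `δ = 0` occurs once for each `t`,
and a `δ` with one nonzero entry occurs once. -/
theorem supportPoly_coeff_one {T : Type*} [Fintype T] [DecidableEq T] (δ : T → ZMod 2) :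
    (supportPoly δ).coeff 1 =
      (-1) ^ (Fintype.card T - 1) * ∑ t, ∑ a, if δ = Pi.single t a then 1 else 0 := by
  have h1 : (supportPoly δ).coeff 1 = (derivative (supportPoly δ)).eval 0 := by
    rw [← coeff_zero_eq_eval_zero, coeff_derivative]
    simp
  rw [h1, supportPoly, derivative_prod_finset, eval_finsetSum, Finset.mul_sum]
  refine Finset.sum_congr rfl fun t _ => ?_
  have h2 : (derivative (if δ t = 0 then X - 1 else X : ℤ[X])) = 1 := by
    split_ifs <;> simp
  rw [h2, mul_one, eval_prod]
  have h3 : (∑ a, if δ = Pi.single t a then (1 : ℤ) else 0) =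
      if δ = Pi.single t (δ t) then 1 else 0 := by
    refine Finset.sum_eq_single _ (fun a _ ha => if_neg ?_) (by simp)
    rintro h
    apply ha
    rw [h, Pi.single_eq_same]
  rw [h3]
  split_ifs with h
  · rw [Finset.prod_congr rfl (g := fun _ => (-1 : ℤ)), Finset.prod_const,
      Finset.card_erase_of_mem (Finset.mem_univ _), Finset.card_univ, mul_one]
    intro s hs
    rw [h, if_pos (by rw [Pi.single_eq_of_ne (Finset.ne_of_mem_erase hs)])]
    simp
  · obtain ⟨s, hs⟩ := Function.ne_iff.mp h
    have hst : s ≠ t := by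
      rintro rfl
      simp at hs
    rw [Pi.single_eq_of_ne hst] at hs
    rw [mul_zero]
    refine Finset.prod_eq_zero (Finset.mem_erase.mpr ⟨hst, Finset.mem_univ s⟩) ?_
    rw [if_neg hs, eval_X]

end Counting

/-! ### The two lowest coefficients. -/

section Counting

variable {L : ℕ} {κ : Type*} {ℓ : κ → ℕ}

open Polynomial

theorem Fin.partialSum_zero_fun {A : Type*} [AddCommMonoid A] {n : ℕ} (k : Fin (n + 1)) :
    Fin.partialSum (0 : Fin n → A) k = 0 := by
  induction k using Fin.induction with
  | zero => simp
  | succ k ih => simp [Fin.partialSum_succ, ih]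

theorem Fin.partialSum_single {A : Type*} [AddCommMonoid A] {n : ℕ} (j : Fin n) (a : A)
    (k : Fin (n + 1)) :
    Fin.partialSum (Pi.single j a : Fin n → A) k = if j.castSucc < k then a else 0 := by
  induction k using Fin.induction with
  | zero => simp
  | succ k ih =>
    rw [Fin.partialSum_succ, ih, Pi.single_apply]
    simp only [Fin.lt_def, Fin.ext_iff, Fin.val_castSucc, Fin.val_succ]
    rcases lt_trichotomy (j : ℕ) k with h | h | h
    · rw [if_pos h, if_neg (by omega), if_pos (by omega), add_zero]
    · rw [if_neg (by omega), if_pos (by omega), if_pos (by omega), zero_add]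
    · rw [if_neg (by omega), if_neg (by omega), if_neg (by omega), zero_add]

theorem squidWeight_zero_right [Fintype κ] (b : ZMod 2) (δ : Fin L → ZMod 2) :
    squidWeight (ℓ := ℓ) b δ 0 =
      b.val + ∑ k : Fin L, (b + Fin.partialSum δ k.succ).val + (∑ i, ℓ i) * b.val := by
  have h0 : ∀ i : κ, (fun k : Fin (ℓ i) => (0 : (Σ i, Fin (ℓ i)) → ZMod 2) ⟨i, k⟩) = 0 :=
    fun _ => rfl
  simp only [squidWeight, Fintype.sum_option, Fintype.sum_sum_type, SquidVertex.ofIncrements, h0,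
    Fin.partialSum_zero_fun, add_zero]
  simp [add_assoc]

theorem squidWeight_zero_zero [Fintype κ] (b : ZMod 2) :
    squidWeight (ℓ := ℓ) b (0 : Fin L → ZMod 2) 0 = (1 + L + ∑ i, ℓ i) * b.val := by
  rw [squidWeight_zero_right]
  simp only [Fin.partialSum_zero_fun, add_zero, Finset.sum_const, Finset.card_univ,
    Fintype.card_fin, smul_eq_mul]
  ring

/-- A single jump at `t` separates the outer part of the tentacle, from the vertex `t` to the tip,
from the rest of the squid. -/
theorem squidWeight_single [Fintype κ] [DecidableEq κ] (t : Σ i, Fin (ℓ i)) :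
    squidWeight (0 : ZMod 2) (0 : Fin L → ZMod 2) (Pi.single t 1) = ℓ t.1 - t.2 := by
  obtain ⟨i, k⟩ := t
  have hi : (fun k' : Fin (ℓ i) => (Pi.single (⟨i, k⟩ : Σ i, Fin (ℓ i)) (1 : ZMod 2) :
      (Σ i, Fin (ℓ i)) → ZMod 2) ⟨i, k'⟩) = Pi.single k 1 := by
    funext k'
    simp [Pi.single_apply]
  have hj : ∀ j ≠ i, (fun k' : Fin (ℓ j) => (Pi.single (⟨i, k⟩ : Σ i, Fin (ℓ i)) (1 : ZMod 2) :
      (Σ i, Fin (ℓ i)) → ZMod 2) ⟨j, k'⟩) = 0 := by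
    intro j hj
    funext k'
    simp [hj]
  simp only [squidWeight, Fintype.sum_option, Fintype.sum_sum_type, SquidVertex.ofIncrements,
    Fin.partialSum_zero_fun, zero_add, ZMod.val_zero, Finset.sum_const_zero]
  rw [Fintype.sum_sigma, Finset.sum_eq_single i]
  · simp only [hi, Fin.partialSum_single, Fin.castSucc_lt_succ_iff, apply_ite ZMod.val,
      ZMod.val_zero]
    rw [Finset.sum_ite, Finset.sum_const_zero, add_zero, Finset.sum_const]
    have : Finset.univ.filter (fun x => k ≤ x) = Finset.Ici k := by ext; simp
    rw [this, Fin.card_Ici]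
    simp [ZMod.val_one]
  · intro j _ hji
    simp [hj j hji, Fin.partialSum_zero_fun]
  · simp

/-- Changing the value at the center exchanges the two sides of the cut. -/
theorem squidWeight_one_add [Fintype κ] (δ : Fin L → ZMod 2) (δ' : (Σ i, Fin (ℓ i)) → ZMod 2) :
    squidWeight (1 : ZMod 2) δ δ' + squidWeight 0 δ δ' = 1 + L + ∑ i, ℓ i := by
  have h : ∀ x : ZMod 2, (1 + x).val + x.val = 1 := by decide
  have h1 : ∀ v, SquidVertex.ofIncrements (1 : ZMod 2) δ δ' v =
      1 + SquidVertex.ofIncrements (0 : ZMod 2) δ δ' v := by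
    rintro (_ | _ | _) <;> simp [SquidVertex.ofIncrements]
  simp only [squidWeight, h1, ← Finset.sum_add_distrib, h]
  simp
  omega

/-- Only the trivial cut has nonzero constant terms in both factors, and weight `0` then forces `b =
0`. This coefficient yields the length of the cycle. -/
theorem squidPoly_zero_coeff_one [Fintype κ] [DecidableEq κ] :
    (squidPoly L ℓ 0).coeff 1 = (-1) ^ (L + ∑ i, ℓ i) * (L : ℤ) := by
  have h : ∀ (b : ZMod 2) (δ : Fin L → ZMod 2) (δ' : (Σ i, Fin (ℓ i)) → ZMod 2),
      (if squidWeight b δ δ' = 0 then X * (cyclePoly δ * supportPoly δ') else 0 : ℤ[X]).coeff 1 =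
      if δ' = 0 then if δ = 0 then if b = 0 then (-1) ^ (L + ∑ i, ℓ i) * (L : ℤ) else 0
        else 0 else 0 := by
    intro b δ δ'
    rw [apply_ite (fun p : ℤ[X] => p.coeff 1), coeff_X_mul, mul_coeff_zero, cyclePoly_coeff_zero,
      supportPoly_coeff_zero, coeff_zero]
    by_cases h' : δ' = 0
    · by_cases h : δ = 0
      · subst h h'
        rw [squidWeight_zero_zero]
        have hb : (1 + L + ∑ i, ℓ i) * b.val = 0 ↔ b = 0 := by
          rw [mul_eq_zero, ZMod.val_eq_zero, or_iff_right (by omega)]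
        simp only [if_true, Fintype.card_sigma, Fintype.card_fin, hb, pow_add]
        split_ifs <;> ring
      · simp [h]
    · simp [h']
  simp only [squidPoly, finsetSum_coeff, h, Finset.sum_ite_eq', Finset.mem_univ, if_true]

/-- The part of the second coefficient of the polynomial of a squid that depends only on the
length of the cycle and on the number of vertices. -/
noncomputable def squidCoeffCycle (L N j : ℕ) : ℤ :=
  (∑ b : ZMod 2, ∑ δ : Fin L → ZMod 2,
    if b.val + ∑ k : Fin L, (b + Fin.partialSum δ k.succ).val + N * b.val = j then
      (cyclePoly δ).coeff 1 * (-1) ^ N else 0) +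
  (-1) ^ L * L * (-1) ^ (N - 1) *
    ∑ b : ZMod 2, (N : ℤ) * if (1 + L + N) * b.val = j then 1 else 0

/-- After the factor `X`, one of `cyclePoly` and `supportPoly` contributes its constant term and the
other its linear term. So the cut is trivial on all tentacles, which depends only on `L`, the total
tentacle length and `j`, or it is trivial on the cycle and crosses at most one tentacle edge. The
two summands for `t` are the two sides of its cut. If there are no tentacle vertices, the truncated
exponent does no harm, as it multiplies zero. -/
theorem squidPoly_coeff_two [Fintype κ] [DecidableEq κ] (j : ℕ) :
    (squidPoly L ℓ j).coeff 2 = squidCoeffCycle L (∑ i, ℓ i) j +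
      (-1) ^ L * L * (-1) ^ (∑ i, ℓ i - 1) *
        ∑ t : Σ i, Fin (ℓ i), ((if ℓ t.1 - t.2 = j then 1 else 0) +
          if 1 + L + ∑ i, ℓ i - (ℓ t.1 - t.2) = j then 1 else 0) := by
  have h2 : ∀ f : ZMod 2 → ℤ, ∑ a, f a = f 0 + f 1 := Fin.sum_univ_two
  set N := ∑ i, ℓ i with hN
  set C : ℤ := (-1) ^ L * L * (-1) ^ (N - 1) with hC
  have hsplit : ∀ (b : ZMod 2) (δ : Fin L → ZMod 2) (δ' : (Σ i, Fin (ℓ i)) → ZMod 2),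
      (if squidWeight b δ δ' = j then X * (cyclePoly δ * supportPoly δ') else 0 : ℤ[X]).coeff 2 =
      (if δ' = 0 then if squidWeight b δ δ' = j then (cyclePoly δ).coeff 1 * (-1) ^ N else 0
        else 0) +
      ∑ t, ∑ a, (if δ' = Pi.single t a then if δ = 0 then if squidWeight b δ δ' = j then C else 0
        else 0 else 0) := by
    intro b δ δ'
    rw [apply_ite (fun p : ℤ[X] => p.coeff 2), coeff_X_mul, mul_coeff_one, cyclePoly_coeff_zero,
      supportPoly_coeff_zero, supportPoly_coeff_one, coeff_zero]
    simp only [Fintype.card_sigma, Fintype.card_fin, ← hN]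
    by_cases hw : squidWeight b δ δ' = j
    · simp only [hw, if_true]
      rw [add_comm]
      congr 1
      · simp
      · by_cases hδ : δ = 0
        · simp only [hδ, if_true, ← hC, Finset.mul_sum, mul_ite, mul_one, mul_zero]
        · simp [hδ]
    · simp [hw]
  have hsum : ∀ (b : ZMod 2) (δ : Fin L → ZMod 2), (∑ δ' : (Σ i, Fin (ℓ i)) → ZMod 2,
      ∑ t, ∑ a, (if δ' = Pi.single t a then if δ = 0 then if squidWeight b δ δ' = j then C else 0
        else 0 else 0)) = if δ = 0 then ∑ t : Σ i, Fin (ℓ i), ∑ a,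
          if squidWeight b δ (Pi.single t a) = j then C else 0 else 0 := by
    intro b δ
    rw [Finset.sum_comm]
    by_cases hδ : δ = 0
    · simp only [hδ, if_true]
      refine Finset.sum_congr rfl fun t _ => ?_
      rw [Finset.sum_comm]
      refine Finset.sum_congr rfl fun a _ => ?_
      rw [Finset.sum_ite_eq']
      simp
    · simp [hδ]
  have h1 : ∀ t : Σ i, Fin (ℓ i), squidWeight (1 : ZMod 2) (0 : Fin L → ZMod 2) (Pi.single t 1) =
      1 + L + N - (ℓ t.1 - t.2) := by
    intro t
    rw [← squidWeight_single (L := L) t, hN, 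
      ← squidWeight_one_add (0 : Fin L → ZMod 2) (Pi.single t 1)]
    omega
  simp only [squidPoly, finsetSum_coeff, hsplit, Finset.sum_add_distrib, hsum,
    Finset.sum_ite_eq', Finset.mem_univ, if_true]
  rw [squidCoeffCycle, add_assoc]
  congr 1
  · simp only [squidWeight_zero_right, ← hN]
  -- Terms with `a = 0` are trivial cuts and give the factor `N` in `squidCoeffCycle`; those with `a
  -- = 1` are the genuine tentacle cuts.
  · simp only [h2, Pi.single_zero, squidWeight_zero_zero, squidWeight_single, h1, ← hN, ← hC,
      Finset.sum_add_distrib, Finset.sum_const, Finset.card_univ, Fintype.card_sigma,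
      Fintype.card_fin, nsmul_eq_mul, mul_add, Finset.mul_sum, mul_ite, mul_one, mul_zero]
    ring_nf

end Counting

/-! ### Recovering the tentacle lengths. -/

section Tentacles

/-- The number of tentacles of length at least `s`. -/
def tentacleCount {κ : Type*} [Fintype κ] (ℓ : κ → ℕ) (s : ℕ) : ℕ :=
  Fintype.card {i // s ≤ ℓ i}

variable {κ κ' : Type*} [Fintype κ] [Fintype κ']

theorem tentacleCount_antitone (ℓ : κ → ℕ) : Antitone (tentacleCount ℓ) := fun _ _ h =>
  Fintype.card_subtype_mono _ _ fun _ hi => h.trans hi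

theorem tentacleCount_eq_add (ℓ : κ → ℕ) (s : ℕ) :
    tentacleCount ℓ s = Fintype.card {i // ℓ i = s} + tentacleCount ℓ (s + 1) := by
  classical
  rw [tentacleCount, tentacleCount, ← Fintype.card_subtype_or_disjoint]
  · exact Fintype.card_congr (Equiv.subtypeEquivRight fun i => by omega)
  · intro p h1 h2 i hi
    have := h1 i hi
    have := h2 i hi
    simp only at *
    omega

theorem tentacleCount_mul_le (ℓ : κ → ℕ) (s : ℕ) : tentacleCount ℓ s * s ≤ ∑ i, ℓ i := by
  classical
  rw [tentacleCount, Fintype.card_subtype, ← smul_eq_mul, ← Finset.sum_const]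
  refine (Finset.sum_le_sum fun i hi => (Finset.mem_filter.mp hi).2).trans ?_
  exact Finset.sum_le_sum_of_subset (Finset.filter_subset _ _)

/-- A second tentacle of length at least `s` would, together with `i`, exceed the total length. -/
theorem tentacleCount_eq_one {ℓ : κ → ℕ} {i : κ} {s : ℕ} (hs : s ≤ ℓ i)
    (h : ∑ i, ℓ i < ℓ i + s) : tentacleCount ℓ s = 1 := by
  classical
  rw [tentacleCount, Fintype.card_eq_one_iff]
  refine ⟨⟨i, hs⟩, fun ⟨k, hk⟩ => Subtype.ext ?_⟩
  by_contra hne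
  have : ∑ j ∈ {i, k}, ℓ j ≤ ∑ j, ℓ j := Finset.sum_le_sum_of_subset (Finset.subset_univ _)
  rw [Finset.sum_pair (Ne.symm hne)] at this
  have hk' : s ≤ ℓ k := hk
  dsimp only at this
  omega

/-- A tentacle has exactly one edge that cuts off `s` vertices if its length is at least `s`, and
none otherwise. -/
theorem sum_tentacles (ℓ : κ → ℕ) {s : ℕ} (hs : 0 < s) :
    ∑ t : Σ i, Fin (ℓ i), (if ℓ t.1 - t.2 = s then (1 : ℤ) else 0) = tentacleCount ℓ s := by
  classical
  rw [Fintype.sum_sigma, tentacleCount, Fintype.card_subtype, Finset.card_filter, Nat.cast_sum]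
  refine Finset.sum_congr rfl fun i _ => ?_
  by_cases h : s ≤ ℓ i
  · rw [if_pos h, Finset.sum_eq_single ⟨ℓ i - s, by omega⟩, if_pos]
    · simp
    · simp; omega
    · rintro ⟨k, hk⟩ _ hne
      refine if_neg fun h' => hne ?_
      simp only [Fin.mk.injEq] at *
      omega
    · simp
  · rw [if_neg h, Nat.cast_zero]
    exact Finset.sum_eq_zero fun k _ => if_neg (by dsimp only; omega)

/-- As `2 * s > n`, the first squid has a single tentacle `i` of length at least `s` and the second
has none. Comparing at `j = ℓ i` gives `tentacleCount ℓ' (n - ℓ i) = 2`; comparing at `j = ℓ i + 1`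
gives `tentacleCount ℓ' (n - ℓ i - 1) = 1`. This contradicts antitonicity. -/
theorem tentacleCount_not_long {L n N : ℕ} {ℓ : κ → ℕ} {ℓ' : κ' → ℕ} (hL : 0 < L)
    (hn : n = 1 + L + N) (hN : ∑ i, ℓ i = N) (hN' : ∑ i, ℓ' i = N)
    (h : ∀ j, 0 < j → j < n → tentacleCount ℓ j + tentacleCount ℓ (n - j) =
      tentacleCount ℓ' j + tentacleCount ℓ' (n - j)) {s : ℕ} (hs : n < 2 * s)
    (h1 : tentacleCount ℓ' s < tentacleCount ℓ s) : False := by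
  have h2 : tentacleCount ℓ' s = 0 ∨ tentacleCount ℓ' s = 1 := by
    by_contra hc
    have := tentacleCount_mul_le ℓ' s
    have : 2 * s ≤ tentacleCount ℓ' s * s := Nat.mul_le_mul_right _ (by omega)
    omega
  have h3 : tentacleCount ℓ s ≤ 1 := by
    by_contra hc
    have := tentacleCount_mul_le ℓ s
    have : 2 * s ≤ tentacleCount ℓ s * s := Nat.mul_le_mul_right _ (by omega)
    omega
  obtain ⟨i, hi⟩ : ∃ i, s ≤ ℓ i := by
    by_contra! hc
    have : tentacleCount ℓ s = 0 := by
      rw [tentacleCount, Fintype.card_eq_zero_iff]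
      exact ⟨fun i => absurd i.2 (by have := hc i.1; omega)⟩
    omega
  have hiN : ℓ i ≤ N := hN ▸ Finset.single_le_sum (fun _ _ => Nat.zero_le _) (Finset.mem_univ i)
  have e1 := h (ℓ i) (by omega) (by omega)
  have e2 := h (ℓ i + 1) (by omega) (by omega)
  have a1 : tentacleCount ℓ (ℓ i) = 1 := tentacleCount_eq_one le_rfl (by omega)
  have a2 : tentacleCount ℓ (n - ℓ i) = 1 := tentacleCount_eq_one (i := i) (by omega) (by omega)
  -- Here `0 < L` is essential: the total tentacle length must be less than `n - 1`.
  have a3 : tentacleCount ℓ (n - (ℓ i + 1)) = 1 :=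
    tentacleCount_eq_one (i := i) (by omega) (by omega)
  have b1 := tentacleCount_antitone ℓ' hi
  have b2 := tentacleCount_antitone ℓ' (Nat.le_succ (ℓ i))
  have b3 := tentacleCount_antitone ℓ' (show n - (ℓ i + 1) ≤ n - ℓ i by omega)
  have b4 := tentacleCount_eq_add ℓ (ℓ i)
  have b5 : 0 < Fintype.card {k // ℓ k = ℓ i} := Fintype.card_pos_iff.mpr ⟨⟨i, rfl⟩⟩
  simp only [Nat.succ_eq_add_one] at b2
  omega

/-- Beyond `n / 2` neither squid can have the larger count; below, the value follows from the one at
`n - s`, and at `s = n / 2` the sum is twice the count. -/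
theorem tentacleCount_determined {L n N : ℕ} {ℓ : κ → ℕ} {ℓ' : κ' → ℕ} (hL : 0 < L)
    (hn : n = 1 + L + N) (hN : ∑ i, ℓ i = N) (hN' : ∑ i, ℓ' i = N)
    (h : ∀ j, 0 < j → j < n → tentacleCount ℓ j + tentacleCount ℓ (n - j) =
      tentacleCount ℓ' j + tentacleCount ℓ' (n - j)) {s : ℕ} (hs : 0 < s) :
    tentacleCount ℓ s = tentacleCount ℓ' s := by
  have hlong : ∀ s, n < 2 * s → tentacleCount ℓ s = tentacleCount ℓ' s := by
    intro s hs
    rcases lt_trichotomy (tentacleCount ℓ s) (tentacleCount ℓ' s) with h1 | h1 | h1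
    · exact (tentacleCount_not_long hL hn hN' hN (fun j h0 hj => (h j h0 hj).symm) hs h1).elim
    · exact h1
    · exact (tentacleCount_not_long hL hn hN hN' h hs h1).elim
  rcases lt_trichotomy (2 * s) n with h1 | h1 | h1
  · have := h s hs (by omega)
    have := hlong (n - s) (by omega)
    omega
  · have := h s hs (by omega)
    rw [show n - s = s by omega] at this
    omega
  · exact hlong s h1

theorem exists_equiv_of_tentacleCount_eq {ℓ : κ → ℕ} {ℓ' : κ' → ℕ} (hℓ : ∀ i, 0 < ℓ i)
    (hℓ' : ∀ i, 0 < ℓ' i) (h : ∀ s, 0 < s → tentacleCount ℓ s = tentacleCount ℓ' s) :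
    ∃ e : κ ≃ κ', ∀ i, ℓ' (e i) = ℓ i := by
  have hf : ∀ s, Fintype.card {i // ℓ i = s} = Fintype.card {i // ℓ' i = s} := by
    intro s
    rcases Nat.eq_zero_or_pos s with rfl | hs
    · rw [Fintype.card_eq_zero_iff.mpr ⟨fun i => (hℓ i.1).ne' i.2⟩,
        Fintype.card_eq_zero_iff.mpr ⟨fun i => (hℓ' i.1).ne' i.2⟩]
    · have := tentacleCount_eq_add ℓ s
      have := tentacleCount_eq_add ℓ' s
      have := h s hs
      have := h (s + 1) (by omega)
      omega
  exact ⟨Equiv.ofFiberEquiv fun s => Fintype.equivOfCardEq (hf s), Equiv.ofFiberEquiv_map _⟩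

/-- The lengths of the cycle and of the tentacles determine a squid up to isomorphism. -/
theorem nonempty_squidGraph_iso {L : ℕ} {κ κ' : Type*} {ℓ : κ → ℕ} {ℓ' : κ' → ℕ} (e : κ ≃ κ')
    (h : ∀ i, ℓ' (e i) = ℓ i) : Nonempty (squidGraph L ℓ ≃g squidGraph L ℓ') := by
  obtain rfl : ℓ = fun i => ℓ' (e i) := funext fun i => (h i).symm
  let φ : SquidVertex L (fun i => ℓ' (e i)) ≃ SquidVertex L ℓ' :=
    Equiv.optionCongr (Equiv.sumCongr (Equiv.refl _)
      (Equiv.sigmaCongrLeft (β := fun i => Fin (ℓ' i)) e))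
  have h1 : ∀ k, φ (SquidVertex.onCycle k) = SquidVertex.onCycle k := by
    intro k
    cases k using Fin.cases <;> rfl
  have h2 : ∀ i k, φ (SquidVertex.onTentacle i k) = SquidVertex.onTentacle (e i) k := by
    intro i k
    cases k using Fin.cases <;> rfl
  have h0 : φ none = none := rfl
  refine ⟨⟨φ, fun {u v} => ?_⟩⟩
  have h1' : ∀ u k, φ u = SquidVertex.onCycle k ↔ u = SquidVertex.onCycle k := fun u k => by
    rw [← h1, φ.apply_eq_iff_eq]
  have h0' : ∀ u, φ u = none ↔ u = none := fun u => by
    rw [← h0, φ.apply_eq_iff_eq]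
  have h2' : ∀ u i k, φ u = SquidVertex.onTentacle (e i) k ↔ u = SquidVertex.onTentacle i k :=
    fun u i k => by rw [← h2, φ.apply_eq_iff_eq]
  simp only [squidGraph, SimpleGraph.fromRel_adj, ne_eq, φ.apply_eq_iff_eq, h1', h0', h2',
    e.surjective.exists]

/-- The counting polynomials determine the lengths of the cycle and of the tentacles. -/
theorem squidGraph_iso_of_poly {L L' : ℕ} {κ κ' : Type*} [Fintype κ] [Fintype κ'] [DecidableEq κ]
    [DecidableEq κ'] {ℓ : κ → ℕ} {ℓ' : κ' → ℕ}
    (hL : 0 < L) (hℓ : ∀ i, 0 < ℓ i) (hℓ' : ∀ i, 0 < ℓ' i)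
    (hn : 1 + L + ∑ i, ℓ i = 1 + L' + ∑ i, ℓ' i)
    (hP : ∀ j, squidPoly L ℓ j = squidPoly L' ℓ' j) :
    Nonempty (squidGraph L ℓ ≃g squidGraph L' ℓ') := by
  obtain rfl : L = L' := by
    have h := congrArg (fun p => Polynomial.coeff p 1) (hP 0)
    simp only [squidPoly_zero_coeff_one] at h
    rw [show L + ∑ i, ℓ i = L' + ∑ i, ℓ' i by omega] at h
    exact_mod_cast mul_left_cancel₀ (pow_ne_zero _ (by norm_num)) h
  have hN : ∑ i, ℓ' i = ∑ i, ℓ i := by omega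
  have hcount : ∀ j, 0 < j → j < 1 + L + ∑ i, ℓ i →
      tentacleCount ℓ j + tentacleCount ℓ (1 + L + ∑ i, ℓ i - j) =
      tentacleCount ℓ' j + tentacleCount ℓ' (1 + L + ∑ i, ℓ i - j) := by
    intro j h0 hj
    have h := congrArg (fun p => Polynomial.coeff p 2) (hP j)
    simp only [squidPoly_coeff_two, hN] at h
    -- The cycle part is the same on both sides, and the common factor `± L` is nonzero.
    have h := mul_left_cancel₀ (mul_ne_zero (mul_ne_zero (pow_ne_zero _ (by norm_num))
      (by exact_mod_cast hL.ne')) (pow_ne_zero _ (by norm_num))) (add_left_cancel h)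
    have hflip : ∀ x, x ≤ ∑ i, ℓ i →
        (1 + L + ∑ i, ℓ i - x = j ↔ x = 1 + L + ∑ i, ℓ i - j) := by omega
    have hle : ∀ t : Σ i, Fin (ℓ i), ℓ t.1 - t.2 ≤ ∑ i, ℓ i := fun t =>
      (Nat.sub_le _ _).trans
        (Finset.single_le_sum (f := ℓ) (fun _ _ => Nat.zero_le _) (Finset.mem_univ t.1))
    have hle' : ∀ t : Σ i, Fin (ℓ' i), ℓ' t.1 - t.2 ≤ ∑ i, ℓ i := fun t =>
      (Nat.sub_le _ _).trans (hN ▸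
        (Finset.single_le_sum (f := ℓ') (fun _ _ => Nat.zero_le _) (Finset.mem_univ t.1)))
    simp only [hflip _ (hle _), hflip _ (hle' _), Finset.sum_add_distrib] at h
    rw [sum_tentacles ℓ h0, sum_tentacles ℓ' h0, sum_tentacles ℓ (by omega),
      sum_tentacles ℓ' (by omega)] at h
    exact_mod_cast h
  obtain ⟨e, he⟩ := exists_equiv_of_tentacleCount_eq hℓ hℓ' fun s hs =>
    tentacleCount_determined hL rfl rfl hN hcount hs
  exact nonempty_squidGraph_iso e he

end Tentacles

/-! ### Coordinates on a spider with one leg joined to the center. -/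

namespace SimpleGraph

variable {V : Type*} {G T : SimpleGraph V} {c x : V}

theorem IsTree.exists_parent (hT : T.IsTree) {c v : V} (hv : v ≠ c) :
    ∃ u, T.Adj v u ∧ T.dist c v = T.dist c u + 1 := by
  obtain ⟨p, hp⟩ := (hT.connected c v).exists_walk_length_eq_dist
  have hnil : ¬ p.Nil := fun h => hv h.eq.symm
  have hadj := p.adj_penultimate hnil
  refine ⟨p.penultimate, hadj.symm, ?_⟩
  rcases hT.dist_eq_dist_add_one_of_adj c hadj with h | h
  · have h1 := dist_le p.dropLast
    have h2 := p.length_dropLast_add_one hnil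
    omega
  · exact h

theorem IsTree.parent_unique (hT : T.IsTree) {c v u u' : V} (hu : T.Adj v u) (hu' : T.Adj v u')
    (hd : T.dist c v = T.dist c u + 1) (hd' : T.dist c v = T.dist c u' + 1) : u = u' := by
  obtain ⟨p, hp⟩ := (hT.connected c u).exists_walk_length_eq_dist
  obtain ⟨p', hp'⟩ := (hT.connected c u').exists_walk_length_eq_dist
  have h1 : (p.concat hu.symm).IsPath :=
    Walk.isPath_of_length_eq_dist _ (by rw [Walk.length_concat, hp, hd])
  have h2 : (p'.concat hu'.symm).IsPath :=
    Walk.isPath_of_length_eq_dist _ (by rw [Walk.length_concat, hp', hd'])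
  have h := (hT.existsUnique_path c v).unique h1 h2
  rw [← p.penultimate_concat hu.symm, h, p'.penultimate_concat]

/-- A graph that arises from a spider by joining the end of a leg to the center is a squid, given
by the lengths of its cycle and of its tentacles. -/
theorem exists_squidGraph_iso_of_isTree [Finite V] (hT : T.IsTree) (hxc : x ≠ c)
    (hGT : ∀ u v, G.Adj u v ↔ T.Adj u v ∨ (u = c ∧ v = x) ∨ (u = x ∧ v = c))
    (hchild : ∀ u v v', u ≠ c → T.Adj u v → T.Adj u v' → T.dist c v = T.dist c u + 1 →
      T.dist c v' = T.dist c u + 1 → v = v')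
    (hx : ∀ v, T.Adj x v → T.dist c v ≠ T.dist c x + 1) :
    ∃ (L : ℕ) (s : Set V) (ℓ : s → ℕ), 0 < L ∧ (∀ i, 0 < ℓ i) ∧
      Nonempty (squidGraph L ℓ ≃g G) := by
  set d : V → ℕ := T.dist c with hd
  have hd0 : ∀ v, d v = 0 ↔ v = c := fun v => by
    rw [hd, hT.connected.dist_eq_zero_iff, eq_comm]
  choose! par hpar using fun v (hv : v ≠ c) => hT.exists_parent hv
  have hpar_unique : ∀ u v, T.Adj v u → d v = d u + 1 → u = par v := fun u v h h' =>
    hT.parent_unique h (hpar v (by rw [ne_eq, ← hd0]; omega)).1 h'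
      (hpar v (by rw [ne_eq, ← hd0]; omega)).2
  have hpos : ∀ v, v ≠ c → 0 < d v := fun v hv => by
    have := (hd0 v).not.mpr hv
    omega
  have hpar_inj : ∀ v v', v ≠ c → v' ≠ c → par v ≠ c → par v = par v' → v = v' := by
    intro v v' hv hv' hp h
    have h1 := hpar v hv
    have h2 := hpar v' hv'
    rw [← h] at h2
    exact hchild (par v) v v' hp h1.1.symm h2.1.symm h1.2 h2.2
  have hpar_c : ∀ v, v ≠ c → (par v = c ↔ d v = 1) := fun v hv => by
    have h2 : d v = d (par v) + 1 := (hpar v hv).2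
    rw [← hd0]
    omega
  -- A leg is named by its vertex adjacent to `c`. Leg and distance from `c` together are
  -- coordinates on the vertices other than `c`: injective by `hinj`, and without gaps along a leg
  -- by `hlower`.
  let top : V → V := fun v => par^[d v - 1] v
  have htop1 : ∀ v, d v = 1 → top v = v := fun v hv => by simp [top, hv]
  have htop_par : ∀ v, v ≠ c → d v ≠ 1 → top (par v) = top v := by
    intro v hv h1
    have h2 : d v = d (par v) + 1 := (hpar v hv).2
    obtain ⟨k, hk⟩ : ∃ k, d (par v) = k + 1 := ⟨d (par v) - 1, by omega⟩
    simp only [top, h2, hk]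
    rfl
  have htop_d : ∀ n v, d v = n + 1 → d (top v) = 1 := by
    intro n
    induction n with
    | zero => intro v hv; rw [htop1 v hv, hv]
    | succ n ih =>
      intro v hv
      have hvc : v ≠ c := by rw [ne_eq, ← hd0]; omega
      have h2 : d v = d (par v) + 1 := (hpar v hvc).2
      rw [← htop_par v hvc (by omega)]
      exact ih _ (by omega)
  have hinj : ∀ n v v', d v = n + 1 → d v' = n + 1 → top v = top v' → v = v' := by
    intro n
    induction n with
    | zero => intro v v' hv hv' h; rwa [htop1 v hv, htop1 v' hv'] at h
    | succ n ih =>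
      intro v v' hv hv' h
      have hvc : v ≠ c := by rw [ne_eq, ← hd0]; omega
      have hvc' : v' ≠ c := by rw [ne_eq, ← hd0]; omega
      have h2 : d v = d (par v) + 1 := (hpar v hvc).2
      have h2' : d v' = d (par v') + 1 := (hpar v' hvc').2
      refine hpar_inj v v' hvc hvc' (by rw [ne_eq, hpar_c v hvc]; omega) ?_
      refine ih _ _ (by omega) (by omega) ?_
      rw [htop_par v hvc (by omega), htop_par v' hvc' (by omega), h]
  have hlower : ∀ m v k, d v = k + 1 + m → ∃ w, top w = top v ∧ d w = k + 1 := by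
    intro m
    induction m with
    | zero => intro v k hv; exact ⟨v, rfl, hv⟩
    | succ m ih =>
      intro v k hv
      have hvc : v ≠ c := by rw [ne_eq, ← hd0]; omega
      have h2 : d v = d (par v) + 1 := (hpar v hvc).2
      obtain ⟨w, hw, hw'⟩ := ih (par v) k (by omega)
      exact ⟨w, by rw [hw, htop_par v hvc (by omega)], hw'⟩
  have hmax : ∀ y, d y = 1 → ∃ w, top w = y ∧ 0 < d w ∧
      ∀ v, top v = y → v ≠ c → d v ≤ d w := by
    intro y hy
    obtain ⟨w, ⟨hw, hw'⟩, hmax⟩ := Set.exists_max_image {v | top v = y ∧ v ≠ c} d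
      (Set.toFinite _) ⟨y, htop1 y hy, by rw [ne_eq, ← hd0]; omega⟩
    exact ⟨w, hw, hpos w hw', fun v h h' => hmax v ⟨h, h'⟩⟩
  choose! tip htip_top htip_pos htip_max using hmax
  let len : V → ℕ := fun y => d (tip y)
  -- Positions on a leg start at `0`, so position `k` is at distance `k + 1`.
  have hvert : ∀ y k, d y = 1 ∧ k < len y → ∃ w, top w = y ∧ d w = k + 1 := by
    rintro y k ⟨hy, hk⟩
    obtain ⟨w, hw, hw'⟩ := hlower (len y - (k + 1)) (tip y) k (by simp only [len] at *; omega)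
    exact ⟨w, by rw [hw, htip_top y hy], hw'⟩
  choose! vert hvert_top hvert_d using hvert
  have hvert_eq : ∀ v, v ≠ c → d (top v) = 1 ∧ d v - 1 < len (top v) ∧
      v = vert (top v) (d v - 1) := by
    intro v hv
    have h0 := hpos v hv
    have h1 := htop_d (d v - 1) v (by omega)
    have h2 : d v - 1 < len (top v) := by
      have := htip_max (top v) h1 v rfl hv
      simp only [len]
      omega
    exact ⟨h1, h2, hinj (d v - 1) _ _ (by omega) (hvert_d _ _ ⟨h1, h2⟩)
      (hvert_top _ _ ⟨h1, h2⟩).symm⟩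
  have hvert_c : ∀ y k, d y = 1 → k < len y → vert y k ≠ c := by
    intro y k hy hk
    have := hvert_d y k ⟨hy, hk⟩
    rw [ne_eq, ← hd0]
    omega
  have hvert_zero : ∀ y, d y = 1 → par (vert y 0) = c := fun y hy =>
    (hpar_c _ (hvert_c y 0 hy (htip_pos y hy))).mpr (hvert_d y 0 ⟨hy, htip_pos y hy⟩)
  have hvert_succ : ∀ y k, d y = 1 → k + 1 < len y → par (vert y (k + 1)) = vert y k := by
    intro y k hy hk
    have h1 := hvert_d y (k + 1) ⟨hy, hk⟩
    have h2 : d _ = d _ + 1 := (hpar _ (hvert_c y (k + 1) hy hk)).2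
    refine hinj k _ _ (by omega) (hvert_d y k ⟨hy, by omega⟩) ?_
    rw [htop_par _ (hvert_c y (k + 1) hy hk) (by omega), hvert_top y _ ⟨hy, hk⟩,
      hvert_top y _ ⟨hy, by omega⟩]
  obtain ⟨hy0, hlx, hvx⟩ := hvert_eq x hxc
  set y0 := top x with hy0_def
  -- The vertex `x` is the tip of its leg: otherwise the next vertex on the leg would be a child of
  -- `x`. This leg becomes the cycle, and the others are the tentacles.
  have hlen0 : len y0 = d x := by
    have h0 := hpos x hxc
    by_contra hne
    have h1 := hvert_succ y0 (d x - 1) hy0 (by omega)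
    rw [← hvx, show d x - 1 + 1 = d x by omega] at h1
    have h2 := hpar _ (hvert_c y0 (d x) hy0 (by omega))
    rw [h1] at h2
    exact hx _ h2.1.symm h2.2
  let s : Set V := {y | d y = 1 ∧ y ≠ y0}
  let ℓ : s → ℕ := fun i => len i.1
  let ψ : SquidVertex (len y0) ℓ → V
    | none => c
    | some (.inl k) => vert y0 k
    | some (.inr ⟨i, k⟩) => vert i.1 k
  have hψ1 : ∀ k : Fin (len y0), par (ψ (SquidVertex.onCycle k.succ)) =
      ψ (SquidVertex.onCycle k.castSucc) := by
    rintro ⟨_ | k, hk⟩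
    · exact hvert_zero y0 hy0
    · exact hvert_succ y0 k hy0 hk
  have hψ2 : ∀ (i : s) (k : Fin (ℓ i)), par (ψ (SquidVertex.onTentacle i k.succ)) =
      ψ (SquidVertex.onTentacle i k.castSucc) := by
    rintro i ⟨_ | k, hk⟩
    · exact hvert_zero i.1 i.2.1
    · exact hvert_succ i.1 k i.2.1 hk
  have hψx : ψ (SquidVertex.onCycle (Fin.last _)) = x := by
    have h0 := hpos x hxc
    obtain ⟨m, hm⟩ : ∃ m, len y0 = m + 1 := ⟨d x - 1, by omega⟩
    have : Fin.last (len y0) = Fin.succ ⟨m, by omega⟩ := by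
      ext
      simp [hm]
    rw [this, SquidVertex.onCycle_succ]
    change vert y0 m = x
    rw [hvx]
    congr 1
    omega
  have hψc : ∀ v, v ≠ none → ψ v ≠ c := by
    rintro (_ | k | ⟨i, k⟩) h
    · exact absurd rfl h
    · exact hvert_c y0 k hy0 k.2
    · exact hvert_c i.1 k i.2.1 k.2
  have hψ_inj : Function.Injective ψ := by
    have hkey : ∀ y y' k k', d y = 1 → d y' = 1 → k < len y → k' < len y' →
        vert y k = vert y' k' → y = y' ∧ k = k' := by
      intro y y' k k' hy hy' hk hk' h
      have h1 := hvert_d y k ⟨hy, hk⟩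
      have h2 := hvert_top y k ⟨hy, hk⟩
      rw [h, hvert_d y' k' ⟨hy', hk'⟩] at h1
      rw [h, hvert_top y' k' ⟨hy', hk'⟩] at h2
      exact ⟨h2.symm, by omega⟩
    rintro (_ | k | ⟨i, k⟩) (_ | k' | ⟨i', k'⟩) h
    · rfl
    · exact (hψc (some (.inl k')) (Option.some_ne_none _) h.symm).elim
    · exact (hψc (some (.inr ⟨i', k'⟩)) (Option.some_ne_none _) h.symm).elim
    · exact (hψc (some (.inl k)) (Option.some_ne_none _) h).elim
    · rw [Fin.ext (hkey _ _ _ _ hy0 hy0 k.2 k'.2 h).2]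
    · exact absurd (hkey _ _ _ _ hy0 i'.2.1 k.2 k'.2 h).1.symm i'.2.2
    · exact (hψc (some (.inr ⟨i, k⟩)) (Option.some_ne_none _) h).elim
    · exact absurd (hkey _ _ _ _ i.2.1 hy0 k.2 k'.2 h).1 i.2.2
    · obtain ⟨h1, h2⟩ := hkey _ _ _ _ i.2.1 i'.2.1 k.2 k'.2 h
      obtain rfl := Subtype.ext h1
      rw [Fin.ext h2]
  have hψ_surj : Function.Surjective ψ := by
    intro v
    by_cases hv : v = c
    · exact ⟨none, hv.symm⟩
    · obtain ⟨h1, h2, h3⟩ := hvert_eq v hv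
      by_cases h : top v = y0
      · rw [h] at h2 h3
        exact ⟨some (.inl ⟨_, h2⟩), h3.symm⟩
      · exact ⟨some (.inr ⟨⟨top v, h1, h⟩, ⟨_, h2⟩⟩), h3.symm⟩
  have hadj_par : ∀ v, v ≠ none → T.Adj (par (ψ v)) (ψ v) := fun v hv =>
    (hpar _ (hψc v hv)).1.symm
  have hto : ∀ u v, ((∃ k : Fin (len y0), u = SquidVertex.onCycle k.castSucc ∧
      v = SquidVertex.onCycle k.succ) ∨
      (u = SquidVertex.onCycle (Fin.last _) ∧ v = none) ∨
      (∃ i, ∃ k : Fin (ℓ i), u = SquidVertex.onTentacle i k.castSucc ∧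
        v = SquidVertex.onTentacle i k.succ)) → G.Adj (ψ u) (ψ v) := by
    rintro u v (⟨k, rfl, rfl⟩ | ⟨rfl, rfl⟩ | ⟨i, k, rfl, rfl⟩)
    · rw [hGT, ← hψ1]
      exact .inl (hadj_par (SquidVertex.onCycle k.succ) (Option.some_ne_none _))
    · rw [hGT, hψx]
      exact .inr (.inr ⟨rfl, rfl⟩)
    · rw [hGT, ← hψ2]
      exact .inl (hadj_par (SquidVertex.onTentacle i k.succ) (Option.some_ne_none _))
  have hfrom : ∀ u v, ψ u = par (ψ v) → v ≠ none →
      ((∃ k : Fin (len y0), u = SquidVertex.onCycle k.castSucc ∧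
      v = SquidVertex.onCycle k.succ) ∨
      (u = SquidVertex.onCycle (Fin.last _) ∧ v = none) ∨
      (∃ i, ∃ k : Fin (ℓ i), u = SquidVertex.onTentacle i k.castSucc ∧
        v = SquidVertex.onTentacle i k.succ)) := by
    rintro u (_ | k | ⟨i, k⟩) h hv
    · exact absurd rfl hv
    · exact .inl ⟨k, hψ_inj (h.trans (hψ1 k)), rfl⟩
    · exact .inr (.inr ⟨i, k, hψ_inj (h.trans (hψ2 i k)), rfl⟩)
  have hx_iff : ∀ u, ψ u = x → u = SquidVertex.onCycle (Fin.last _) := fun u h =>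
    hψ_inj (h.trans hψx.symm)
  have hc_iff : ∀ u, ψ u = c → u = none := fun u h => by
    by_contra h'
    exact hψc u h' h
  refine ⟨len y0, s, ℓ, htip_pos y0 hy0, fun i => htip_pos i.1 i.2.1,
    ⟨⟨Equiv.ofBijective ψ ⟨hψ_inj, hψ_surj⟩, fun {u v} => ?_⟩⟩⟩
  change G.Adj (ψ u) (ψ v) ↔ _
  rw [squidGraph, fromRel_adj]
  constructor
  · intro h
    refine ⟨fun h' => h.ne (congrArg ψ h'), ?_⟩
    rcases (hGT _ _).mp h with h | ⟨h1, h2⟩ | ⟨h1, h2⟩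
    · rcases hT.dist_eq_dist_add_one_of_adj c h with h' | h'
      · refine .inr (hfrom v u (hpar_unique _ _ h h') ?_)
        rintro rfl
        have : d c = 0 := (hd0 c).mpr rfl
        change d c = _ at h'
        omega
      · refine .inl (hfrom u v (hpar_unique _ _ h.symm h') ?_)
        rintro rfl
        have : d c = 0 := (hd0 c).mpr rfl
        change d c = _ at h'
        omega
    · exact .inr (.inr (.inl ⟨hx_iff v h2, hc_iff u h1⟩))
    · exact .inl (.inr (.inl ⟨hx_iff u h1, hc_iff v h2⟩))
  · rintro ⟨-, h | h⟩
    exacts [hto u v h, (hto v u h).symm]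

end SimpleGraph

/-! ### Squids are the model squids. -/

namespace SimpleGraph

theorem card_coloring_congr {V W A : Type*} [Fintype V] [Fintype W] {G : SimpleGraph V}
    {H : SimpleGraph W} (e : G ≃g H) (φ : A → ℕ) (j : ℕ) :
    Nat.card {f : G.Coloring A // ∑ v, φ (f v) = j} =
      Nat.card {f : H.Coloring A // ∑ v, φ (f v) = j} := by
  refine Nat.card_congr
    { toFun f := ⟨f.1.comp e.symm.toHom, ?_⟩
      invFun f := ⟨f.1.comp e.toHom, ?_⟩
      left_inv f := ?_
      right_inv f := ?_ }
  · exact (Equiv.sum_comp e.symm.toEquiv fun v => φ (f.1 v)).trans f.2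
  · exact (Equiv.sum_comp e.toEquiv fun v => φ (f.1 v)).trans f.2
  · refine Subtype.ext (DFunLike.ext _ _ fun v => ?_)
    exact congrArg f.1 (e.symm_apply_apply v)
  · refine Subtype.ext (DFunLike.ext _ _ fun v => ?_)
    exact congrArg f.1 (e.apply_symm_apply v)

theorem eq_or_eq_or_eq_of_degree_le_two {V : Type*} {G : SimpleGraph V} {v a b d : V}
    [Fintype (G.neighborSet v)] (h : ¬ 2 < G.degree v) (ha : G.Adj v a) (hb : G.Adj v b)
    (hd : G.Adj v d) : a = b ∨ a = d ∨ b = d := by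
  classical
  by_contra! hne
  have hsub : ({a, b, d} : Finset V) ⊆ G.neighborFinset v := by
    intro w hw
    simp only [Finset.mem_insert, Finset.mem_singleton] at hw
    rw [mem_neighborFinset]
    rcases hw with rfl | rfl | rfl <;> assumption
  have h1 := Finset.card_le_card hsub
  rw [Finset.card_eq_three.mpr ⟨a, b, d, hne.1, hne.2.1, hne.2.2, rfl⟩,
    card_neighborFinset_eq_degree] at h1
  omega

/-- In a connected graph, a vertex lies on every cycle if all other vertices have degree at most
`2`. -/
theorem Walk.IsCycle.mem_support_of_degree {V : Type*} {G : SimpleGraph V} [G.LocallyFinite]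
    (hG : G.Connected) {c v : V} (hc : ∀ u, 2 < G.degree u → u = c) {p : G.Walk v v}
    (hp : p.IsCycle) : c ∈ p.support := by
  by_contra hcp
  obtain ⟨w⟩ := hG v c
  -- A walk from the cycle to `c` leaves the cycle at a vertex with two neighbours on the cycle and
  -- a third off it.
  obtain ⟨d, -, hd1, hd2⟩ := w.exists_boundary_dart {u | u ∈ p.support} p.start_mem_support hcp
  have h2 := hp.ncard_neighborSet_toSubgraph_eq_two hd1
  obtain ⟨a, b, hab, hs⟩ := Set.ncard_eq_two.mp h2
  have ha : p.toSubgraph.Adj d.fst a :=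
    (hs ▸ Set.mem_insert a {b} : a ∈ p.toSubgraph.neighborSet d.fst)
  have hb : p.toSubgraph.Adj d.fst b :=
    (hs ▸ Set.mem_insert_of_mem a rfl : b ∈ p.toSubgraph.neighborSet d.fst)
  have ha' : a ∈ p.support := p.mem_verts_toSubgraph.mp ha.snd_mem
  have hb' : b ∈ p.support := p.mem_verts_toSubgraph.mp hb.snd_mem
  have hdc : d.fst ≠ c := fun h => hcp (h ▸ hd1)
  rcases eq_or_eq_or_eq_of_degree_le_two (fun h => hdc (hc _ h)) ha.adj_sub hb.adj_sub d.adj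
    with h | h | h
  · exact hab h
  · exact hd2 (h ▸ ha')
  · exact hd2 (h ▸ hb')

/-- Every squid is given by the lengths of its cycle and of its tentacles. -/
theorem IsSquid.exists_iso {V : Type*} [Finite V] {G : SimpleGraph V} [G.LocallyFinite]
    (hG : G.IsSquid) : ∃ (L : ℕ) (s : Set V) (ℓ : s → ℕ), 0 < L ∧ (∀ i, 0 < ℓ i) ∧
      Nonempty (squidGraph L ℓ ≃g G) := by
  classical
  obtain ⟨hconn, ⟨C, ⟨v, p, hp, hpC⟩, huniq⟩, c, -, hc⟩ := hG
  have hcp := hp.mem_support_of_degree hconn hc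
  have hq := hp.rotate hcp
  have hqC : (p.rotate c hcp).toSubgraph = C := by rw [p.toSubgraph_rotate hcp, hpC]
  set q := p.rotate c hcp
  set x := q.snd
  have hadj : G.Adj c x := q.adj_snd hq.not_nil
  have hmem : s(c, x) ∈ q.edges := q.mk_start_snd_mem_edges hq.not_nil
  -- Deleting a cycle edge at the center keeps the graph connected, and any remaining cycle would be
  -- the unique cycle `C`, which contains the deleted edge. The result is a spider.
  set T := G.deleteEdges {s(c, x)}
  have hTG : ∀ u v, T.Adj u v ↔ G.Adj u v ∧ s(u, v) ≠ s(c, x) := fun u v => by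
    simp [T, deleteEdges_adj]
  have hT : T.IsTree := by
    refine ⟨hconn.connected_delete_edge_of_not_isBridge
      fun h => h.notMem_edges_of_isCycle hq hmem, ?_⟩
    intro u w hw
    have h1 : (w.mapLe (G.deleteEdges_le {s(c, x)})).toSubgraph = C :=
      huniq _ ⟨u, _, hw.mapLe _, rfl⟩
    rw [← q.mem_edges_toSubgraph, hqC, ← h1, Walk.mem_edges_toSubgraph,
      Walk.edges_mapLe_eq_edges] at hmem
    exact ((hTG _ _).mp (w.adj_of_mem_edges hmem)).2 rfl
  have hdeg : ∀ u, u ≠ c → ∀ a b d, G.Adj u a → G.Adj u b → G.Adj u d → a = b ∨ a = d ∨ b = d :=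
    fun u hu a b d => eq_or_eq_or_eq_of_degree_le_two fun h => hu (hc u h)
  have hle : ∀ {u v}, T.Adj u v → G.Adj u v := fun h => ((hTG _ _).mp h).1
  refine exists_squidGraph_iso_of_isTree hT hadj.ne' (fun u v => ?_) ?_ ?_
  · rw [hTG, ne_eq, Sym2.eq_iff]
    constructor
    · intro h
      by_cases h' : (u = c ∧ v = x) ∨ u = x ∧ v = c
      · exact .inr h'
      · exact .inl ⟨h, h'⟩
    · rintro (h | ⟨rfl, rfl⟩ | ⟨rfl, rfl⟩)
      exacts [h.1, hadj, hadj.symm]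
  · intro u v v' hu hv hv' hd hd'
    obtain ⟨w, hw, hwd⟩ := hT.exists_parent hu
    rcases hdeg u hu _ _ _ (hle hw) (hle hv) (hle hv') with rfl | rfl | h
    · omega
    · omega
    · exact h
  -- A child of `x` would be a third neighbour in `G`, besides its parent in `T` and `c`.
  · intro v hv hd
    obtain ⟨w, hw, hwd⟩ := hT.exists_parent hadj.ne'
    rcases hdeg x hadj.ne' _ _ _ (hle hw) (hle hv) hadj.symm with rfl | rfl | rfl
    · omega
    · exact ((hTG _ _).mp hw).2 Sym2.eq_swap
    · exact ((hTG _ _).mp hv).2 Sym2.eq_swap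

end SimpleGraph

theorem SimpleGraph.nonempty_iso_of_squidGraph_iso {V W κ κ' : Type*} [Fintype V] [Fintype W]
    [Fintype κ] [Fintype κ'] [DecidableEq κ] [DecidableEq κ'] {G : SimpleGraph V}
    {H : SimpleGraph W} {L L' : ℕ} {ℓ : κ → ℕ} {ℓ' : κ' → ℕ} (e : squidGraph L ℓ ≃g G)
    (e' : squidGraph L' ℓ' ≃g H) (hL : 0 < L) (hL' : 0 < L') (hℓ : ∀ i, 0 < ℓ i)
    (hℓ' : ∀ i, 0 < ℓ' i) (hX : G.chromaticSymmetricFunction = H.chromaticSymmetricFunction) :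
    Nonempty (G ≃g H) := by
  have hn : 1 + L + ∑ i, ℓ i = 1 + L' + ∑ i, ℓ' i := by
    have h := card_eq_of_chromaticSymmetricFunction_eq hX
    rw [← Fintype.card_congr e.toEquiv, ← Fintype.card_congr e'.toEquiv] at h
    simp only [Fintype.card_option, Fintype.card_sum, Fintype.card_fin, Fintype.card_sigma] at h
    omega
  have hcard : ∀ (j q : ℕ), NeZero q →
      Nat.card {f : (squidGraph L ℓ).Coloring (ZMod q × ZMod 2) // ∑ v, (f v).2.val = j} =
      Nat.card {f : (squidGraph L' ℓ').Coloring (ZMod q × ZMod 2) // ∑ v, (f v).2.val = j} :=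
    fun j q _ => (card_coloring_congr e (fun a : ZMod q × ZMod 2 => a.2.val) j).trans
      ((card_coloring_eq hX (fun a : ZMod q × ZMod 2 => a.2.val) j).trans
        (card_coloring_congr e' (fun a : ZMod q × ZMod 2 => a.2.val) j).symm)
  obtain ⟨f⟩ := squidGraph_iso_of_poly hL hℓ hℓ' hn fun j =>
    squidPoly_eq_of_card_eq hL hL' j (hcard j)
  exact ⟨(e.symm.trans f).trans e'⟩

/-- No two non-isomorphic squids have the same chromatic symmetric function. -/
theorem mainTheorem3 {V W : Type*} [Fintype V] [Fintype W]
    (G : SimpleGraph V) (H : SimpleGraph W) [DecidableRel G.Adj] [DecidableRel H.Adj]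
    (hG : G.IsSquid) (hH : H.IsSquid)
    (hX : G.chromaticSymmetricFunction = H.chromaticSymmetricFunction) :
    Nonempty (G ≃g H) := by
  classical
  obtain ⟨L, s, ℓ, hL, hℓ, ⟨e⟩⟩ := hG.exists_iso
  obtain ⟨L', s', ℓ', hL', hℓ', ⟨e'⟩⟩ := hH.exists_iso
  have := Fintype.ofFinite s
  have := Fintype.ofFinite s'
  exact SimpleGraph.nonempty_iso_of_squidGraph_iso e e' hL hL' hℓ hℓ' hX
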